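/- Let $d\ge 1$ and $s\in(0,1]$. For $x\in\mathbb Z^d$ let $|x|=(x_1^2+\dots+x_d^2)^{1/2}$, and put $\mathbb T^d=[-\pi,\pi]^d$ and $\omega(\xi)=4\sum_{j=1}^d\sin^2(\xi_j/2)$. For $f\in\ell^1(\mathbb Z^d)$ (complex-valued) let $\widehat f(\xi)=(2\pi)^{-d/2}\sum_{x\in\mathbb Z^d}f(x)e^{-i\langle x,\xi\rangle}$, and let $(-\Delta)^s$ be the fractional power of the discrete Laplacian on $\mathbb Z^d$, defined as the Fourier multiplier $\widehat{(-\Delta)^sf}(\xi)=\omega(\xi)^s\widehat f(\xi)$, $\xi\in\mathbb T^d$. For $t\ge0$ and $x\in\mathbb Z^d$ let \[ G_t^{(s)}(x)=\frac1{(2\pi)^d}\int_{\mathbb T^d}e^{-t\omega(\xi)^s}e^{i\langle x,\xi\rangle}\,d\xi . \] For every $u_0\in\ell^1(\mathbb Z^d)$ the Cauchy problem \[ \partial_tu+(-\Delta)^su=0\quad(t>0),\qquad u(0)=u_0, \] has a unique solution $u$ in $\ell^1(\mathbb Z^d)$ (continuous on $[0,\infty)$ and differentiable on $(0,\infty)$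 as an $\ell^1(\mathbb Z^d)$-valued function), and it is given by \[ u(t,x)=(G_t^{(s)}*u_0)(x)=\sum_{y\in\mathbb Z^d}G_t^{(s)}(x-y)\,u_0(y),\qquad t\ge0,\ x\in\mathbb Z^d . \] Moreover, there is a constant $C=C(d,s)>0$ such that the following holds for every $u_0\in\ell^1(\mathbb Z^d)$ with finite first moment $\mathcal N_1(u_0)=\sum_{x\in\mathbb Z^d}|x|\,|u_0(x)|<\infty$. Let $M=\sum_{x\in\mathbb Z^d}u_0(x)$, and let $u(t)=u(t,\cdot)$ be the solution above. Then, for all $t>0$, \[ t^{\frac d{2s}}\,\|u(t)-M G_t^{(s)}\|_{\ell^\infty(\mathbb Z^d)}\le C\,\mathcal N_1(u_0)\,t^{-\frac1{2s}}, \qquad \|u(t)-M G_t^{(s)}\|_{\ell^1(\mathbb Z^d)}\le C\,\mathcal N_1(u_0)\,t^{-\frac1{2s}}, \] and, for every $1\le p\le\infty$ (with the same constant $C$, and $1/\infty=0$), \[ t^{\frac d{2s}\left(1-\frac1p\right)}\,\|u(t)-M G_t^{(s)}\|_{\ell^p(\mathbb Z^d)}\le C\,\mathcal N_1(u_0)\,t^{-\frac1{2s}}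 . \] -/

import Mathlib

noncomputable section

namespace LatticeDiffusion

/-- The space `ℓ^p(ℤᵈ)` of complex sequences, with its usual norm. -/
abbrev Ell (d : ℕ) (p : ENNReal) : Type := lp (fun _ : Fin d → ℤ => ℂ) p

/-- The pairing `⟨x, ξ⟩ = ∑ⱼ xⱼ ξⱼ` of a lattice point with a frequency. -/
def pairing {d : ℕ} (x : Fin d → ℤ) (ξ : Fin d → ℝ) : ℝ := ∑ j : Fin d, (x j : ℝ) * ξ j

/-- The frequency torus `𝕋ᵈ = [-π, π]ᵈ`. -/
def torus (d : ℕ) : Set (Fin d → ℝ) := Set.univ.pi fun _ => Set.Icc (-Real.pi) Real.pi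

/-- The Fourier transform `û(ξ) = (2π)^{-d/2} ∑ₓ u(x) e^{-i⟨x,ξ⟩}` of `u ∈ ℓ¹(ℤᵈ)`. -/
def fourierZ {d : ℕ} (u : Ell d 1) (ξ : Fin d → ℝ) : ℂ :=
  (((2 * Real.pi) ^ (-(d : ℝ) / 2) : ℝ) : ℂ) *
    ∑' x : Fin d → ℤ, u x * Complex.exp (-(Complex.I * (pairing x ξ : ℂ)))

/-- The symbol `ω(ξ) = 4 ∑ⱼ sin²(ξⱼ / 2)` of the discrete Laplacian `-Δ`. -/
def symbol {d : ℕ} (ξ : Fin d → ℝ) : ℝ := 4 * ∑ j : Fin d, Real.sin (ξ j / 2) ^ 2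

/-- `v = (-Δ)^s f` in `ℓ¹(ℤᵈ)`, where the power `(-Δ)^s` of the discrete Laplacian is the Fourier
multiplier with symbol `ω^s`. For given `f` at most one `v` has this property, because the Fourier
transform is injective on `ℓ¹(ℤᵈ)`. -/
def IsFracLaplacian {d : ℕ} (s : ℝ) (f v : Ell d 1) : Prop :=
  ∀ ξ ∈ torus d, fourierZ v ξ = ((symbol ξ ^ s : ℝ) : ℂ) * fourierZ f ξ

/-- `u` is a (strong) solution in `ℓ¹(ℤᵈ)` of `∂ₜ u + (-Δ)^s u = 0` for `t > 0`, `u(0) = u₀`: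
it is continuous on `[0, ∞)` and differentiable on `(0, ∞)` with values in `ℓ¹(ℤᵈ)`.
The values of `u` at negative times play no role. -/
structure IsSolution {d : ℕ} (s : ℝ) (u₀ : Ell d 1) (u : ℝ → Ell d 1) : Prop where
  continuousOn : ContinuousOn u (Set.Ici 0)
  equation : ∀ t : ℝ, 0 < t → ∃ v : Ell d 1, IsFracLaplacian s (u t) v ∧ HasDerivAt u (-v) t
  initial : u 0 = u₀

/-- The lattice fractional heat kernel
`G_t^{(s)}(x) = (2π)^{-d} ∫_{[-π,π]^d} e^{-t ω(ξ)^s} e^{i⟨x,ξ⟩} dξ`. -/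
def heatKernel {d : ℕ} (s t : ℝ) (x : Fin d → ℤ) : ℂ :=
  (1 / (2 * (Real.pi : ℂ)) ^ d) *
    ∫ ξ in torus d,
      ((Real.exp (-(t * symbol ξ ^ s)) : ℝ) : ℂ) * Complex.exp (Complex.I * (pairing x ξ : ℂ))

/-- The discrete convolution `(f * g)(x) = ∑_y f(x - y) g(y)`. -/
def conv {d : ℕ} (f g : (Fin d → ℤ) → ℂ) : (Fin d → ℤ) → ℂ := fun x =>
  ∑' y : Fin d → ℤ, f (x - y) * g y

/-- The Euclidean length `|x|` of a lattice point. -/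
def euclid {d : ℕ} (x : Fin d → ℤ) : ℝ := Real.sqrt (∑ j : Fin d, (x j : ℝ) ^ 2)

/-- The mass `M = ∑ₓ u₀(x)`. -/
def mass {d : ℕ} (u₀ : (Fin d → ℤ) → ℂ) : ℂ := ∑' x : Fin d → ℤ, u₀ x

/-- The first moment `N₁(u₀) = ∑ₓ |x| |u₀(x)|` is finite. -/
def HasFiniteFirstMoment {d : ℕ} (u₀ : (Fin d → ℤ) → ℂ) : Prop :=
  Summable fun x : Fin d → ℤ => euclid x * ‖u₀ x‖

/-- The first moment `N₁(u₀) = ∑ₓ |x| |u₀(x)|`. -/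
def firstMoment {d : ℕ} (u₀ : (Fin d → ℤ) → ℂ) : ℝ :=
  ∑' x : Fin d → ℤ, euclid x * ‖u₀ x‖

end LatticeDiffusion

end

/-!
Let `Q` be the lazy simple random walk, so that `-Δ = 4d (1 - Q)`. Since
`1 - (1 - r)^s = ∑ aₙ r^(n+1)` with `aₙ ≥ 0` (the Sibuya distribution), `(-Δ)^s` is the bounded
operator `(4d)^s (1 - ∑ aₙ Q^(n+1))` on `ℓ¹`, which gives well-posedness, and `e^{-t(-Δ)^s}` is a
positive combination of powers of `Q`. Because the walk is lazy, `Q` preserves unimodality in each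
coordinate, and hence `G_t` is unimodal in each coordinate. The sum defining `‖G_t - S_{eⱼ} G_t‖₁`
therefore telescopes to twice the sum of `G_t` over the hyperplane `xⱼ = 0`, which is
`π⁻¹ ∫ e^{-t(4 sin²(η/2))^s} dη ≤ C t^{-1/(2s)}`.

Writing `u(t) - M G_t = ∑ u₀(y) (S_y G_t - G_t)` turns this into the `ℓ¹` estimate. Applying the
semigroup over the second half of the time interval, with `‖G_{t/2}‖_∞ ≤ C t^{-d/(2s)}`, gives the
`ℓ^∞` estimate, and interpolation gives the rest.
-/

noncomputable section

namespace LatticeDiffusion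

open MeasureTheory
open scoped ENNReal

section SequenceSpaces

variable {α : Type*} {E : α → Type*} [∀ a, NormedAddCommGroup (E a)]

lemma summable_norm (f : lp E 1) : Summable fun a => ‖f a‖ := by
  simpa using (lp.memℓp f).summable (by simp)

lemma norm_eq_tsum (f : lp E 1) : ‖f‖ = ∑' a, ‖f a‖ := by
  simpa using lp.norm_eq_tsum_rpow (by simp) f

lemma norm_lp_top_le {f : ∀ a, E a} (hf : Memℓp f ∞) {S : ℝ} (hS : 0 ≤ S) (hfS : ∀ a, ‖f a‖ ≤ S) :
    ‖(⟨f, hf⟩ : lp E ∞)‖ ≤ S :=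
  lp.norm_le_of_forall_le hS hfS

lemma memℓp_of_one_le {p : ℝ≥0∞} (hp : 1 ≤ p) (f : lp E 1) : Memℓp (⇑f) p :=
  (lp.memℓp f).of_exponent_ge hp

lemma norm_lp_le_interpolation {p : ℝ≥0∞} (hp : 1 ≤ p) (f : lp E 1) {S : ℝ} (hS : 0 ≤ S)
    (hfS : ∀ a, ‖f a‖ ≤ S) (hf : Memℓp (⇑f) p) :
    ‖(⟨f, hf⟩ : lp E p)‖ ≤ ‖f‖ ^ (p⁻¹).toReal * S ^ (1 - (p⁻¹).toReal) := by
  rcases eq_or_ne p ∞ with rfl | hp'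
  · simpa using norm_lp_top_le hf hS hfS
  have hq : 1 ≤ p.toReal := by simpa using ENNReal.toReal_mono hp' hp
  have hq0 : 0 < p.toReal := zero_lt_one.trans_le hq
  have hpow (a : α) : ‖f a‖ ^ p.toReal ≤ S ^ (p.toReal - 1) * ‖f a‖ := by
    calc ‖f a‖ ^ p.toReal = ‖f a‖ ^ (p.toReal - 1) * ‖f a‖ := by
          rw [← Real.rpow_add_one' (norm_nonneg _) (by simpa using hq0.ne'), sub_add_cancel]
      _ ≤ S ^ (p.toReal - 1) * ‖f a‖ := by
          gcongr
          exact hfS a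
  have hsum : ∑' a, ‖f a‖ ^ p.toReal ≤ S ^ (p.toReal - 1) * ‖f‖ := by
    rw [norm_eq_tsum, ← tsum_mul_left]
    exact (hf.summable hq0).tsum_le_tsum hpow ((summable_norm f).mul_left _)
  rw [lp.norm_eq_tsum_rpow hq0]
  calc (∑' a, ‖f a‖ ^ p.toReal) ^ (1 / p.toReal)
      ≤ (S ^ (p.toReal - 1) * ‖f‖) ^ (1 / p.toReal) := by gcongr
    _ = ‖f‖ ^ (p⁻¹).toReal * S ^ (1 - (p⁻¹).toReal) := by
        rw [Real.mul_rpow (by positivity) (norm_nonneg f), ← Real.rpow_mul hS, mul_comm,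
          ENNReal.toReal_inv, one_div, sub_mul, mul_inv_cancel₀ hq0.ne', one_mul]

lemma weighted_norm_lp_le {p : ℝ≥0∞} (hp : 1 ≤ p) (f : lp E 1) {t δ K : ℝ} (ht : 0 < t)
    (hf₁ : ‖f‖ ≤ K) (hf_top : ∀ a, t ^ δ * ‖f a‖ ≤ K) (hf : Memℓp (⇑f) p) :
    t ^ (δ * (1 - (p⁻¹).toReal)) * ‖(⟨f, hf⟩ : lp E p)‖ ≤ K := by
  have hK : 0 ≤ K := (norm_nonneg f).trans hf₁
  have htδ : 0 < t ^ δ := Real.rpow_pos_of_pos ht δ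
  have : (p⁻¹).toReal ≤ 1 :=
    ENNReal.toReal_le_of_le_ofReal zero_le_one (by simpa using hp)
  have hfS (a : α) : ‖f a‖ ≤ K / t ^ δ := (le_div_iff₀' htδ).mpr (hf_top a)
  calc t ^ (δ * (1 - (p⁻¹).toReal)) * ‖(⟨f, hf⟩ : lp E p)‖
      ≤ t ^ (δ * (1 - (p⁻¹).toReal)) * (K ^ (p⁻¹).toReal * (K / t ^ δ) ^ (1 - (p⁻¹).toReal)) := by
        gcongr
        refine (norm_lp_le_interpolation hp f (by positivity) hfS hf).trans ?_
        gcongr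
    _ = K ^ (p⁻¹).toReal * (t ^ δ * (K / t ^ δ)) ^ (1 - (p⁻¹).toReal) := by
        rw [Real.mul_rpow htδ.le (by positivity), Real.rpow_mul ht.le]
        ring
    _ = K := by
        rw [mul_div_cancel₀ _ htδ.ne', ← Real.rpow_add' hK (by simp), add_sub_cancel,
          Real.rpow_one]

end SequenceSpaces

section Sibuya

/-- The coefficients in `1 - (1 - r) ^ s = ∑ₙ sibuyaCoeff s n * r ^ (n + 1)`. For `s ∈ (0, 1]` they
are the weights of Sibuya's probability distribution on the positive integers. -/
def sibuyaCoeff (s : ℝ) (n : ℕ) : ℝ := (-1) ^ n * Ring.choose s (n + 1)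

lemma sibuyaCoeff_succ (s : ℝ) (n : ℕ) :
    sibuyaCoeff s (n + 1) = sibuyaCoeff s n * ((n + 1 - s) / (n + 2)) := by
  have hsmeval (k : ℕ) := Ring.descPochhammer_eq_factorial_smul_choose s k
  have hchoose : (n + 2 : ℝ) * Ring.choose s (n + 2) = Ring.choose s (n + 1) * (s - (n + 1)) := by
    apply mul_left_cancel₀ (Nat.cast_ne_zero.mpr (n + 1).factorial_ne_zero : _ ≠ (0 : ℝ))
    have h := hsmeval (n + 2)
    rw [descPochhammer_succ_right, Polynomial.smeval_mul, hsmeval (n + 1),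
      Nat.factorial_succ (n + 1)] at h
    simp only [nsmul_eq_mul, Polynomial.smeval_sub, Polynomial.smeval_X, pow_one,
      Polynomial.smeval_natCast, pow_zero, mul_one] at h
    push_cast at h
    linear_combination -h
  rw [sibuyaCoeff, sibuyaCoeff, pow_succ, mul_div_assoc', eq_div_iff (by positivity)]
  linear_combination (-(-1) ^ n) * hchoose

lemma sibuyaCoeff_nonneg {s : ℝ} (hs : s ∈ Set.Ioc 0 1) (n : ℕ) : 0 ≤ sibuyaCoeff s n := by
  induction n with
  | zero => simpa [sibuyaCoeff] using hs.1.le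
  | succ n ih =>
    rw [sibuyaCoeff_succ]
    have : (0 : ℝ) ≤ n + 1 - s := by linarith [hs.2, n.cast_nonneg (α := ℝ)]
    positivity

lemma hasSum_sibuyaCoeff_of_abs_lt_one (s : ℝ) {r : ℝ} (hr : |r| < 1) :
    HasSum (fun n => sibuyaCoeff s n * r ^ (n + 1)) (1 - (1 - r) ^ s) := by
  have h := (Real.one_add_rpow_hasFPowerSeriesOnBall_zero (a := s)).hasSum (y := -r)
    (by simpa [enorm_eq_nnnorm, ← NNReal.coe_lt_coe] using hr)
  rw [← hasSum_nat_add_iff' 1] at h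
  convert! h.neg using 1
  · ext n
    simp only [binomialSeries_apply, List.ofFn_const, List.prod_replicate, smul_eq_mul,
      sibuyaCoeff, neg_pow r, pow_succ]
    ring
  · simp only [Finset.sum_range_one, binomialSeries_apply, List.ofFn_zero, List.prod_nil,
      Ring.choose_zero_right, smul_eq_mul, mul_one]
    ring_nf

lemma summable_sibuyaCoeff {s : ℝ} (hs : s ∈ Set.Ioc 0 1) : Summable (sibuyaCoeff s) := by
  refine summable_of_sum_range_le (c := 1) (sibuyaCoeff_nonneg hs) fun N => ?_
  have hlim : Filter.Tendsto (fun r : ℝ => ∑ n ∈ Finset.range N, sibuyaCoeff s n * r ^ (n + 1))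
      (nhdsWithin 1 (Set.Iio 1)) (nhds (∑ n ∈ Finset.range N, sibuyaCoeff s n * 1 ^ (n + 1))) :=
    Continuous.continuousWithinAt (by fun_prop)
  simp only [one_pow, mul_one] at hlim
  refine le_of_tendsto hlim ?_
  filter_upwards [Ioo_mem_nhdsLT (zero_lt_one (α := ℝ))] with r hr
  have hpartial := sum_le_hasSum (Finset.range N)
    (fun n _ => mul_nonneg (sibuyaCoeff_nonneg hs n) (pow_nonneg hr.1.le _))
    (hasSum_sibuyaCoeff_of_abs_lt_one s (by rw [abs_of_pos hr.1]; exact hr.2))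
  linarith [Real.rpow_nonneg (sub_nonneg.mpr hr.2.le) s]

lemma hasSum_sibuyaCoeff {s r : ℝ} (hs : s ∈ Set.Ioc 0 1) (hr : r ∈ Set.Icc 0 1) :
    HasSum (fun n => sibuyaCoeff s n * r ^ (n + 1)) (1 - (1 - r) ^ s) := by
  have hbound (n : ℕ) (x : ℝ) (hx : x ∈ Set.Icc 0 1) :
      ‖sibuyaCoeff s n * x ^ (n + 1)‖ ≤ sibuyaCoeff s n := by
    rw [Real.norm_of_nonneg (mul_nonneg (sibuyaCoeff_nonneg hs n) (pow_nonneg hx.1 _))]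
    exact mul_le_of_le_one_right (sibuyaCoeff_nonneg hs n) (pow_le_one₀ hx.1 hx.2)
  -- Both sides are continuous up to `r = 1`, which is outside the disc of convergence.
  have heq : Set.EqOn (fun x => ∑' n, sibuyaCoeff s n * x ^ (n + 1))
      (fun x => 1 - (1 - x) ^ s) (Set.Icc 0 1) := by
    refine Set.EqOn.of_subset_closure (s := Set.Ico 0 1) (fun x hx => ?_)
      (continuousOn_tsum (fun n => by fun_prop) (summable_sibuyaCoeff hs) hbound) ?_
      Set.Ico_subset_Icc_self (by rw [closure_Ico zero_ne_one])
    · exact (hasSum_sibuyaCoeff_of_abs_lt_one s (by rw [abs_of_nonneg hx.1]; exact hx.2)).tsum_eq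
    · exact (continuous_const.sub ((continuous_const.sub continuous_id).rpow_const
        fun _ => Or.inr hs.1.le)).continuousOn
  have hsum : Summable fun n => sibuyaCoeff s n * r ^ (n + 1) :=
    .of_norm_bounded (summable_sibuyaCoeff hs) fun n => hbound n r hr
  exact hsum.hasSum_iff.mpr (heq hr)

variable {A : Type*} [NormedRing A] [NormedAlgebra ℝ A]

/-- The operator `1 - (1 - T) ^ s`, as a power series in a contraction `T`. -/
def sibuyaSeries (s : ℝ) (T : A) : A := ∑' n, sibuyaCoeff s n • T ^ (n + 1)

lemma hasSum_sibuyaSeries [CompleteSpace A] {s : ℝ} (hs : s ∈ Set.Ioc 0 1) {T : A} (hT : ‖T‖ ≤ 1) :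
    HasSum (fun n => sibuyaCoeff s n • T ^ (n + 1)) (sibuyaSeries s T) := by
  refine (Summable.of_norm_bounded (summable_sibuyaCoeff hs) fun n => ?_).hasSum
  rw [norm_smul, Real.norm_of_nonneg (sibuyaCoeff_nonneg hs n)]
  exact mul_le_of_le_one_right (sibuyaCoeff_nonneg hs n)
    ((norm_pow_le' T n.succ_pos).trans (pow_le_one₀ (norm_nonneg T) hT))

end Sibuya

section OperatorSeries

variable {E : Type*} [NormedAddCommGroup E] [NormedSpace ℝ E] {T : E →L[ℝ] E}

section Eigenfunctional

variable {F : E →L[ℝ] ℂ} {c : ℝ}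

lemma eigenfunctional_pow (h : ∀ f, F (T f) = c • F f) (n : ℕ) (f : E) :
    F ((T ^ n) f) = c ^ n • F f := by
  induction n with
  | zero => simp
  | succ n ih => rw [pow_succ', mul_apply_eq_comp, h, ih, pow_succ', mul_smul]

lemma eigenfunctional_hasSum {a : ℕ → ℝ} {k : ℕ → ℕ} {S : E →L[ℝ] E} {σ : ℝ}
    (h : ∀ f, F (T f) = c • F f) (hS : HasSum (fun i => a i • T ^ k i) S)
    (hσ : HasSum (fun i => a i * c ^ k i) σ) (f : E) : F (S f) = σ • F f := by
  have hSf := hS.mapL (F.comp (ContinuousLinearMap.apply ℝ E f))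
  simp only [ContinuousLinearMap.comp_apply, ContinuousLinearMap.apply_apply, map_smul,
    eigenfunctional_pow h, ← mul_smul] at hSf
  exact hSf.unique (hσ.smul_const (F f))

lemma eigenfunctional_exp [CompleteSpace E] (h : ∀ f, F (T f) = c • F f) (f : E) :
    F (NormedSpace.exp T f) = Real.exp c • F f := by
  refine eigenfunctional_hasSum h (NormedSpace.exp_series_hasSum_exp' (𝕂 := ℝ) T) ?_ f
  rw [Real.exp_eq_exp_ℝ]
  exact NormedSpace.exp_series_hasSum_exp' (𝕂 := ℝ) c

lemma eigenfunctional_sibuyaSeries [CompleteSpace E] {s : ℝ} (hs : s ∈ Set.Ioc 0 1) (hT : ‖T‖ ≤ 1)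
    (h : ∀ f, F (T f) = c • F f) (hc : c ∈ Set.Icc 0 1) (f : E) :
    F (sibuyaSeries s T f) = (1 - (1 - c) ^ s) • F f :=
  eigenfunctional_hasSum h (hasSum_sibuyaSeries hs hT) (hasSum_sibuyaCoeff hs hc) f

end Eigenfunctional

section InvariantCone

variable {K : ProperCone ℝ E}

lemma mapsTo_cone_pow (hT : Set.MapsTo T K K) (n : ℕ) : Set.MapsTo (T ^ n : E →L[ℝ] E) K K := by
  rw [FunLike.coe_pow_eq_iterate]
  exact hT.iterate n

lemma mapsTo_cone_hasSum {a : ℕ → ℝ} {k : ℕ → ℕ} {S : E →L[ℝ] E} (hT : Set.MapsTo T K K)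
    (ha : ∀ i, 0 ≤ a i) (hS : HasSum (fun i => a i • T ^ k i) S) : Set.MapsTo S K K := by
  intro f hf
  have hSf : HasSum (fun i => a i • (T ^ k i) f) (S f) := hS.mapL (ContinuousLinearMap.apply ℝ E f)
  exact K.isClosed.mem_of_tendsto hSf (Filter.Eventually.of_forall fun I =>
    sum_mem fun i _ => K.smul_mem (mapsTo_cone_pow hT (k i) hf) (ha i))

lemma mapsTo_cone_exp [CompleteSpace E] (hT : Set.MapsTo T K K) :
    Set.MapsTo (NormedSpace.exp T : E →L[ℝ] E) K K :=
  mapsTo_cone_hasSum hT (fun n => by positivity)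
    (NormedSpace.exp_series_hasSum_exp' (𝕂 := ℝ) T)

lemma mapsTo_cone_sibuyaSeries [CompleteSpace E] {s : ℝ} (hs : s ∈ Set.Ioc 0 1) (hT1 : ‖T‖ ≤ 1)
    (hT : Set.MapsTo T K K) : Set.MapsTo (sibuyaSeries s T : E →L[ℝ] E) K K :=
  mapsTo_cone_hasSum hT (sibuyaCoeff_nonneg hs) (hasSum_sibuyaSeries hs hT1)

lemma mapsTo_cone_smul {c : ℝ} (hc : 0 ≤ c) (hT : Set.MapsTo T K K) : Set.MapsTo (c • T) K K :=
  fun _ hf => K.smul_mem (hT hf) hc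

lemma exp_smul_sub_one {A : Type*} [NormedRing A] [NormedAlgebra ℝ A] [CompleteSpace A]
    (c : ℝ) (a : A) :
    NormedSpace.exp (c • (a - 1)) = Real.exp (-c) • NormedSpace.exp (c • a) := by
  let +nondep : NormedAlgebra ℚ A := .restrictScalars ℚ ℝ A
  have hscalar : c • (a - 1) = algebraMap ℝ A (-c) + c • a := by
    rw [Algebra.algebraMap_eq_smul_one]
    module
  rw [hscalar, NormedSpace.exp_add_of_commute (Algebra.commutes _ _),
    ← NormedSpace.algebraMap_exp_comm, ← Real.exp_eq_exp_ℝ, ← Algebra.smul_def]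

/-- Uniformization: `exp (c • (T - 1))` is a positive combination of powers of `T`. -/
lemma mapsTo_cone_exp_smul_sub_one [CompleteSpace E] {c : ℝ} (hc : 0 ≤ c)
    (hT : Set.MapsTo T K K) : Set.MapsTo (NormedSpace.exp (c • (T - 1)) : E →L[ℝ] E) K K := by
  rw [exp_smul_sub_one]
  exact mapsTo_cone_smul (Real.exp_nonneg _) (mapsTo_cone_exp (mapsTo_cone_smul hc hT))

end InvariantCone

end OperatorSeries

section LinearODE

variable {E : Type*} [NormedAddCommGroup E] [NormedSpace ℝ E] [CompleteSpace E] (A : E →L[ℝ] E)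

lemma hasDerivAt_exp_smul_apply (f : E) (t : ℝ) :
    HasDerivAt (fun r : ℝ => NormedSpace.exp (r • A) f) (A (NormedSpace.exp (t • A) f)) t :=
  (ContinuousLinearMap.apply ℝ E f).hasFDerivAt.comp_hasDerivAt t
    (hasDerivAt_exp_smul_const' A t)

variable {A}

lemma eq_exp_smul_apply_of_hasDerivAt {u : ℝ → E} (hcont : ContinuousOn u (Set.Ici 0))
    (hderiv : ∀ t, 0 < t → HasDerivAt u (A (u t)) t) {t : ℝ} (ht : 0 ≤ t) :
    u t = NormedSpace.exp (t • A) (u 0) := by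
  have hlim : Filter.Tendsto (fun r => A (u r)) (nhdsWithin 0 (Set.Ioi 0)) (nhds (A (u 0))) :=
    (A.continuous.tendsto _).comp ((hcont 0 Set.self_mem_Ici).mono_left
      (nhdsWithin_mono 0 Set.Ioi_subset_Ici_self))
  have hderiv_Ici (r : ℝ) (hr : 0 ≤ r) : HasDerivWithinAt u (A (u r)) (Set.Ici r) r := by
    rcases hr.eq_or_lt with rfl | hr
    · refine hasDerivWithinAt_Ici_of_tendsto_deriv (s := Set.Ioi 0)
        (fun r hr => (hderiv r hr).differentiableAt.differentiableWithinAt)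
        ((hcont 0 Set.self_mem_Ici).mono Set.Ioi_subset_Ici_self) self_mem_nhdsWithin
        (hlim.congr' ?_)
      filter_upwards [self_mem_nhdsWithin] with r hr using (hderiv r hr).deriv.symm
    · exact (hderiv r hr).hasDerivWithinAt
  exact ODE_solution_unique (fun _ => A.lipschitz) (hcont.mono Set.Icc_subset_Ici_self)
    (fun r hr => hderiv_Ici r hr.1)
    (fun r _ => (hasDerivAt_exp_smul_apply A (u 0) r).continuousAt.continuousWithinAt)
    (fun r _ => (hasDerivAt_exp_smul_apply A (u 0) r).hasDerivWithinAt) (by simp) ⟨ht, le_rfl⟩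

end LinearODE

section Translation

lemma addGroupSeminorm_zsmul_le {G : Type*} [AddCommGroup G] (p : AddGroupSeminorm G) (n : ℤ)
    (x : G) : p (n • x) ≤ |(n : ℝ)| * p x := by
  let := p.toSeminormedAddCommGroup
  exact norm_zsmul_le n x

lemma addGroupSeminorm_le_sum {ι : Type*} [Fintype ι] [DecidableEq ι]
    (p : AddGroupSeminorm (ι → ℤ)) (y : ι → ℤ) :
    p y ≤ ∑ j, |(y j : ℝ)| * p (Pi.single j 1) := by
  calc p y = p (∑ j, Pi.single j (y j)) := by rw [Finset.univ_sum_single]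
    _ ≤ ∑ j, p (Pi.single j (y j)) :=
        Finset.le_sum_of_subadditive p (map_zero p).le (map_add_le_add p) _ _
    _ ≤ ∑ j, |(y j : ℝ)| * p (Pi.single j 1) := Finset.sum_le_sum fun j _ => by
        simpa [← Pi.single_smul] using addGroupSeminorm_zsmul_le p (y j) (Pi.single j 1)

variable {G : Type*} [AddGroup G] {E : Type*} [NormedAddCommGroup E] [NormedSpace ℝ E]

/-- Translation by `y`, as an isometry of `ℓ¹(G)`. -/
def shift (y : G) : lp (fun _ : G => E) 1 →ₗᵢ[ℝ] lp (fun _ : G => E) 1 where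
  toFun f := ⟨fun x => f (x - y), memℓp_gen <| by
    simpa [Function.comp_def] using (summable_norm f).comp_injective (Equiv.subRight y).injective⟩
  map_add' _ _ := rfl
  map_smul' _ _ := rfl
  norm_map' f := by
    simp only [norm_eq_tsum]
    exact (Equiv.subRight y).tsum_eq fun x => ‖f x‖

@[simp]
lemma shift_apply (y : G) (f : lp (fun _ : G => E) 1) (x : G) : shift y f x = f (x - y) := rfl

lemma shift_zero (f : lp (fun _ : G => E) 1) : shift 0 f = f := by
  ext x
  simp

lemma shift_add (y z : G) (f : lp (fun _ : G => E) 1) :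
    shift (y + z) f = shift z (shift y f) := by
  ext x
  simp [sub_add_eq_sub_sub_swap]

/-- The modulus of continuity `y ↦ ‖f - f(· - y)‖₁` of translation. -/
def translationModulus (f : lp (fun _ : G => E) 1) : AddGroupSeminorm G where
  toFun y := ‖f - shift y f‖
  map_zero' := by rw [shift_zero, sub_self, norm_zero]
  add_le' y z := by
    calc ‖f - shift (y + z) f‖ = ‖f - shift z f + shift z (f - shift y f)‖ := by
          rw [map_sub, shift_add, sub_add_sub_cancel]
      _ ≤ ‖f - shift y f‖ + ‖f - shift z f‖ := by
          rw [add_comm ‖f - shift y f‖, ← (shift z).norm_map (f - shift y f)]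
          exact norm_add_le _ _
  neg' y := by
    rw [← (shift y).norm_map (f - shift (-y) f), map_sub, ← shift_add, neg_add_cancel, shift_zero,
      norm_sub_rev]

end Translation

section Fourier

variable {d : ℕ}

lemma pairing_add (x y : Fin d → ℤ) (ξ : Fin d → ℝ) :
    pairing (x + y) ξ = pairing x ξ + pairing y ξ := by
  simp [pairing, add_mul, Finset.sum_add_distrib]

lemma pairing_neg (x : Fin d → ℤ) (ξ : Fin d → ℝ) : pairing (-x) ξ = -pairing x ξ := by
  simp [pairing]

@[fun_prop]
lemma continuous_pairing (x : Fin d → ℤ) : Continuous (pairing x) := by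
  unfold pairing
  fun_prop

/-- The character `x ↦ e^{-i⟨x,ξ⟩}` of the lattice. -/
def latticeChar (ξ : Fin d → ℝ) (x : Fin d → ℤ) : ℂ :=
  Complex.exp (-(Complex.I * (pairing x ξ : ℂ)))

lemma norm_latticeChar (ξ : Fin d → ℝ) (x : Fin d → ℤ) : ‖latticeChar ξ x‖ = 1 := by
  simp [latticeChar, Complex.norm_exp]

lemma latticeChar_add (ξ : Fin d → ℝ) (x y : Fin d → ℤ) :
    latticeChar ξ (x + y) = latticeChar ξ x * latticeChar ξ y := by
  rw [latticeChar, latticeChar, latticeChar, ← Complex.exp_add, pairing_add]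
  push_cast
  ring_nf

lemma summable_mul_latticeChar (f : Ell d 1) (ξ : Fin d → ℝ) :
    Summable fun x => f x * latticeChar ξ x :=
  .of_norm (by simpa [norm_latticeChar] using summable_norm f)

/-- The unnormalised Fourier transform `f ↦ ∑ₓ f(x) e^{-i⟨x,ξ⟩}` as a functional on `ℓ¹`. -/
def fourierCLM (ξ : Fin d → ℝ) : Ell d 1 →L[ℂ] ℂ :=
  LinearMap.mkContinuous
    { toFun := fun f => ∑' x, f x * latticeChar ξ x
      map_add' := fun f g => by
        rw [← (summable_mul_latticeChar f ξ).tsum_add (summable_mul_latticeChar g ξ)]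
        exact tsum_congr fun x => by simp [add_mul]
      map_smul' := fun c f => by
        simp only [lp.coeFn_smul, Pi.smul_apply, smul_eq_mul, mul_assoc, tsum_mul_left,
          RingHom.id_apply] }
    1 fun f => by
      rw [one_mul, norm_eq_tsum]
      exact (norm_tsum_le_tsum_norm (summable_mul_latticeChar f ξ).norm).trans_eq
        (by simp [norm_latticeChar])

lemma fourierCLM_apply (ξ : Fin d → ℝ) (f : Ell d 1) :
    fourierCLM ξ f = ∑' x, f x * latticeChar ξ x := rfl

lemma fourierZ_eq (f : Ell d 1) (ξ : Fin d → ℝ) :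
    fourierZ f ξ = (((2 * Real.pi) ^ (-(d : ℝ) / 2) : ℝ) : ℂ) * fourierCLM ξ f := rfl

lemma fourierCLM_shift (ξ : Fin d → ℝ) (y : Fin d → ℤ) (f : Ell d 1) :
    fourierCLM ξ (shift y f) = latticeChar ξ y * fourierCLM ξ f := by
  rw [fourierCLM_apply, fourierCLM_apply, ← tsum_mul_left, ← (Equiv.addRight y).tsum_eq]
  refine tsum_congr fun x => ?_
  simp only [Equiv.coe_addRight, shift_apply, add_sub_cancel_right, latticeChar_add]
  ring

lemma fourierCLM_single_zero (ξ : Fin d → ℝ) : fourierCLM ξ (lp.single 1 0 1) = 1 := by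
  rw [fourierCLM_apply, tsum_eq_single 0 fun x hx => by simp [lp.single_apply, hx]]
  simp [latticeChar, pairing]

/-- The inverse of the unnormalised Fourier transform. -/
def invFourier (φ : (Fin d → ℝ) → ℂ) (x : Fin d → ℤ) : ℂ :=
  (1 / (2 * (Real.pi : ℂ)) ^ d) *
    ∫ ξ in torus d, φ ξ * Complex.exp (Complex.I * (pairing x ξ : ℂ))

instance isFiniteMeasure_torus : IsFiniteMeasure (volume.restrict (torus d)) :=
  isFiniteMeasure_restrict.mpr (isCompact_univ_pi fun _ => isCompact_Icc).measure_ne_top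

lemma volume_restrict_torus : (volume : Measure (Fin d → ℝ)).restrict (torus d)
    = Measure.pi fun _ => volume.restrict (Set.Icc (-Real.pi) Real.pi) := by
  rw [torus, volume_pi, Measure.restrict_pi_pi]

lemma integral_exp_int (n : ℤ) :
    ∫ η in Set.Icc (-Real.pi) Real.pi, Complex.exp (Complex.I * (n * η))
      = if n = 0 then (2 * Real.pi : ℂ) else 0 := by
  rw [integral_Icc_eq_integral_Ioc,
    ← intervalIntegral.integral_of_le (by linarith [Real.pi_pos])]
  split_ifs with hn
  · simp [hn, two_mul]
  · have hc : Complex.I * n ≠ 0 := mul_ne_zero Complex.I_ne_zero (by exact_mod_cast hn)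
    have h := integral_exp_mul_complex (a := -Real.pi) (b := Real.pi) hc
    simp only [mul_assoc] at h
    rw [h, sub_eq_zero.mpr, zero_div]
    exact Complex.exp_eq_exp_iff_exists_int.mpr ⟨n, by push_cast; ring⟩

lemma integral_torus_exp (x : Fin d → ℤ) :
    ∫ ξ in torus d, Complex.exp (Complex.I * (pairing x ξ : ℂ))
      = if x = 0 then (2 * Real.pi : ℂ) ^ d else 0 := by
  have hprod (ξ : Fin d → ℝ) : Complex.exp (Complex.I * (pairing x ξ : ℂ))
      = ∏ j, Complex.exp (Complex.I * (x j * ξ j)) := by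
    rw [← Complex.exp_sum, ← Finset.mul_sum, pairing]
    push_cast
    rfl
  simp only [hprod]
  rw [volume_restrict_torus, integral_fintype_prod_eq_prod
    (f := fun j (η : ℝ) => Complex.exp (Complex.I * (x j * η)))]
  simp only [integral_exp_int]
  split_ifs with hx
  · simp [hx]
  · obtain ⟨j, hj⟩ := Function.ne_iff.mp hx
    exact Finset.prod_eq_zero (Finset.mem_univ j) (if_neg hj)

lemma integral_tsum_mul {ι α : Type*} [Countable ι] [MeasurableSpace α] {μ : Measure α}
    [IsFiniteMeasure μ] (f : lp (fun _ : ι => ℂ) 1) {g : ι → α → ℂ} {C : ℝ}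
    (hg : ∀ y, AEStronglyMeasurable (g y) μ) (hgC : ∀ y a, ‖g y a‖ ≤ C) :
    ∫ a, ∑' y, f y * g y a ∂μ = ∑' y, f y * ∫ a, g y a ∂μ := by
  have hint (y : ι) : Integrable (g y) μ := .of_bound (hg y) C (.of_forall (hgC y))
  have hnorm (y : ι) : ∫ a, ‖f y * g y a‖ ∂μ ≤ ‖f y‖ * (μ.real Set.univ * C) := by
    calc ∫ a, ‖f y * g y a‖ ∂μ ≤ ∫ _, ‖f y‖ * C ∂μ :=
          integral_mono ((hint y).const_mul (f y)).norm (integrable_const _) fun a => by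
            rw [norm_mul]
            gcongr
            exact hgC y a
      _ = ‖f y‖ * (μ.real Set.univ * C) := by rw [integral_const, smul_eq_mul]; ring
  rw [← (hasSum_integral_of_summable_integral_norm (fun y => (hint y).const_mul (f y))
    (.of_nonneg_of_le (fun y => by positivity) hnorm ((summable_norm f).mul_right _))).tsum_eq]
  exact tsum_congr fun y => integral_const_mul _ _

lemma invFourier_mul_fourierCLM {m : (Fin d → ℝ) → ℂ} {C : ℝ} (hm : Measurable m)
    (hmC : ∀ ξ, ‖m ξ‖ ≤ C) (f : Ell d 1) (x : Fin d → ℤ) :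
    invFourier (fun ξ => m ξ * fourierCLM ξ f) x = conv (invFourier m) f x := by
  have hmul (ξ : Fin d → ℝ) :
      m ξ * fourierCLM ξ f * Complex.exp (Complex.I * (pairing x ξ : ℂ))
        = ∑' y, f y * (m ξ * Complex.exp (Complex.I * (pairing (x - y) ξ : ℂ))) := by
    rw [fourierCLM_apply, ← tsum_mul_left, ← tsum_mul_right]
    refine tsum_congr fun y => ?_
    rw [sub_eq_add_neg, pairing_add, pairing_neg, latticeChar]
    push_cast
    rw [mul_add, Complex.exp_add, mul_neg]
    ring
  simp only [invFourier, conv, hmul]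
  rw [integral_tsum_mul f (C := C), ← tsum_mul_left]
  · exact tsum_congr fun y => by ring
  · exact fun y => (hm.mul (by fun_prop)).aestronglyMeasurable
  · intro y ξ
    simpa [Complex.norm_exp] using hmC ξ

lemma invFourier_one (x : Fin d → ℤ) : invFourier 1 x = if x = 0 then 1 else 0 := by
  have : (2 * (Real.pi : ℂ)) ^ d ≠ 0 := by simp [Real.pi_ne_zero]
  simp only [invFourier, Pi.one_apply, one_mul, integral_torus_exp]
  split_ifs
  · field_simp
  · simp

lemma invFourier_fourierCLM (f : Ell d 1) (x : Fin d → ℤ) :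
    invFourier (fun ξ => fourierCLM ξ f) x = f x := by
  have h := invFourier_mul_fourierCLM (m := 1) (C := 1) measurable_one (by simp) f x
  simpa [conv, invFourier_one, sub_eq_zero] using h

lemma eq_of_fourierCLM_eq {f g : Ell d 1} (h : ∀ ξ ∈ torus d, fourierCLM ξ f = fourierCLM ξ g) :
    f = g := by
  ext x
  rw [← invFourier_fourierCLM f x, ← invFourier_fourierCLM g x, invFourier, invFourier]
  congr 1
  refine setIntegral_congr_fun (MeasurableSet.univ_pi fun _ => measurableSet_Icc) fun ξ hξ => ?_
  simp only [h ξ hξ]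

end Fourier

section Semigroup

variable {d : ℕ}

lemma symbol_nonneg (ξ : Fin d → ℝ) : 0 ≤ symbol ξ := by
  unfold symbol
  positivity

lemma symbol_le (ξ : Fin d → ℝ) : symbol ξ ≤ 4 * d := by
  have h : ∑ j, Real.sin (ξ j / 2) ^ 2 ≤ ∑ _ : Fin d, (1 : ℝ) :=
    Finset.sum_le_sum fun j _ => Real.sin_sq_le_one _
  simpa [symbol] using h

lemma symbol_div_mem_Icc (ξ : Fin d → ℝ) : symbol ξ / (4 * d) ∈ Set.Icc 0 1 :=
  ⟨div_nonneg (symbol_nonneg ξ) (by positivity), div_le_one_of_le₀ (symbol_le ξ) (by positivity)⟩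

/-- One step of the lazy simple random walk in the `j`-th coordinate: stay put with probability
`1/2`, move by `±eⱼ` with probability `1/4` each. -/
def lazyStep (j : Fin d) : Ell d 1 →L[ℝ] Ell d 1 :=
  (4⁻¹ : ℝ) • ((2 : ℝ) • 1 + (shift (Pi.single j 1)).toContinuousLinearMap +
    (shift (-Pi.single j 1)).toContinuousLinearMap)

lemma lazyStep_apply (j : Fin d) (f : Ell d 1) :
    lazyStep j f
      = (4⁻¹ : ℝ) • ((2 : ℝ) • f + shift (Pi.single j 1) f + shift (-Pi.single j 1) f) :=
  rfl

lemma norm_lazyStep_le (j : Fin d) : ‖lazyStep j‖ ≤ 1 := by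
  refine ContinuousLinearMap.opNorm_le_bound _ zero_le_one fun f => ?_
  have h := norm_add₃_le (a := (2 : ℝ) • f) (b := shift (Pi.single j 1) f)
    (c := shift (-Pi.single j 1) f)
  rw [lazyStep_apply, norm_smul, Real.norm_of_nonneg (by norm_num), one_mul]
  rw [norm_smul, Real.norm_of_nonneg zero_le_two, LinearIsometry.norm_map,
    LinearIsometry.norm_map] at h
  linarith

lemma latticeChar_single (ξ : Fin d → ℝ) (j : Fin d) (n : ℤ) :
    latticeChar ξ (Pi.single j n) = Complex.exp (-(Complex.I * (n * ξ j : ℂ))) := by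
  have : pairing (Pi.single j n) ξ = n * ξ j := by
    simp [pairing, Pi.single_apply]
  rw [latticeChar, this]
  push_cast
  rfl

lemma fourierCLM_lazyStep (ξ : Fin d → ℝ) (j : Fin d) (f : Ell d 1) :
    fourierCLM ξ (lazyStep j f) = (1 - Real.sin (ξ j / 2) ^ 2) • fourierCLM ξ f := by
  have hcos : Complex.exp (-(Complex.I * ξ j)) + Complex.exp (Complex.I * ξ j)
      = 2 - 4 * Complex.sin (ξ j / 2) ^ 2 := by
    have hhalf : Complex.cos (ξ j) = 1 - 2 * Complex.sin (ξ j / 2) ^ 2 := by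
      rw [← mul_div_cancel₀ (ξ j : ℂ) two_ne_zero, Complex.cos_two_mul', Complex.cos_sq']
      ring_nf
    have hexp := Complex.two_cos (x := ξ j)
    ring_nf at hexp hhalf ⊢
    linear_combination -hexp + 2 * hhalf
  have hshift : fourierCLM ξ (shift (Pi.single j 1) f) + fourierCLM ξ (shift (-Pi.single j 1) f)
      = (2 - 4 * Complex.sin (ξ j / 2) ^ 2) * fourierCLM ξ f := by
    rw [← hcos, fourierCLM_shift, fourierCLM_shift, ← Pi.single_neg, latticeChar_single,
      latticeChar_single, ← add_mul]
    push_cast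
    ring_nf
  rw [lazyStep_apply, ContinuousLinearMap.map_smul_of_tower, map_add, map_add,
    ContinuousLinearMap.map_smul_of_tower, add_assoc, hshift]
  simp only [Complex.real_smul]
  push_cast
  ring

/-- The transition operator `Q = 1 + Δ / (4d)` of the lazy simple random walk. -/
def lazyWalk (d : ℕ) : Ell d 1 →L[ℝ] Ell d 1 := (d : ℝ)⁻¹ • ∑ j, lazyStep j

lemma norm_lazyWalk_le (d : ℕ) : ‖lazyWalk d‖ ≤ 1 := by
  calc ‖lazyWalk d‖ = (d : ℝ)⁻¹ * ‖∑ j, lazyStep j‖ := by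
        rw [lazyWalk, norm_smul, Real.norm_of_nonneg (by positivity)]
    _ ≤ (d : ℝ)⁻¹ * d := by
        gcongr
        exact (norm_sum_le_of_le _ fun j _ => norm_lazyStep_le j).trans_eq (by simp)
    _ ≤ 1 := inv_mul_le_one

/-- The fractional Laplacian `(-Δ)^s = (4d)^s (1 - Q)^s` as a bounded operator on `ℓ¹`, where
`1 - (1 - Q)^s` is given by its binomial series in the lazy walk `Q`. -/
def fracLap (d : ℕ) (s : ℝ) : Ell d 1 →L[ℝ] Ell d 1 :=
  (4 * d : ℝ) ^ s • (1 - sibuyaSeries s (lazyWalk d))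

/-- The heat semigroup `e^{-t(-Δ)^s}` on `ℓ¹`. -/
def heatOp (d : ℕ) (s t : ℝ) : Ell d 1 →L[ℝ] Ell d 1 := NormedSpace.exp (t • -fracLap d s)

lemma heatOp_eq_exp_smul_sub_one (d : ℕ) (s t : ℝ) :
    heatOp d s t = NormedSpace.exp ((t * (4 * d) ^ s) • (sibuyaSeries s (lazyWalk d) - 1)) := by
  rw [heatOp, fracLap, ← smul_neg, neg_sub, smul_smul]

lemma heatOp_zero (d : ℕ) (s : ℝ) : heatOp d s 0 = 1 := by
  rw [heatOp, zero_smul, NormedSpace.exp_zero]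

variable [NeZero d]

lemma fourierCLM_lazyWalk (ξ : Fin d → ℝ) (f : Ell d 1) :
    fourierCLM ξ (lazyWalk d f) = (1 - symbol ξ / (4 * d)) • fourierCLM ξ f := by
  have hd : (d : ℝ) ≠ 0 := NeZero.ne _
  have hmean : 1 - symbol ξ / (4 * d) = (d : ℝ)⁻¹ * ∑ j, (1 - Real.sin (ξ j / 2) ^ 2) := by
    rw [Finset.sum_sub_distrib, Finset.sum_const, Finset.card_univ, Fintype.card_fin, nsmul_one,
      symbol]
    field_simp
  rw [hmean, mul_smul, Finset.sum_smul, lazyWalk, smul_apply,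
    ContinuousLinearMap.map_smul_of_tower, sum_apply, map_sum]
  simp only [fourierCLM_lazyStep]

variable {s : ℝ}

lemma fourierCLM_fracLap (hs : s ∈ Set.Ioc 0 1) (ξ : Fin d → ℝ) (f : Ell d 1) :
    fourierCLM ξ (fracLap d s f) = symbol ξ ^ s • fourierCLM ξ f := by
  have hr := symbol_div_mem_Icc ξ
  have hseries := eigenfunctional_sibuyaSeries (F := (fourierCLM ξ).restrictScalars ℝ) hs
    (norm_lazyWalk_le d) (fourierCLM_lazyWalk ξ) ⟨sub_nonneg.mpr hr.2, sub_le_self 1 hr.1⟩ f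
  have hscale : symbol ξ ^ s = (4 * d : ℝ) ^ s * (symbol ξ / (4 * d)) ^ s := by
    rw [← Real.mul_rpow (by positivity) hr.1, mul_div_cancel₀ _ (by simp [NeZero.ne])]
  rw [sub_sub_cancel, ContinuousLinearMap.coe_restrictScalars'] at hseries
  rw [fracLap, smul_apply, ContinuousLinearMap.map_smul_of_tower, sub_apply, map_sub, hseries,
    one_apply_eq_self, hscale, sub_smul, one_smul, sub_sub_cancel, mul_smul]

lemma fourierCLM_heatOp (hs : s ∈ Set.Ioc 0 1) (t : ℝ) (ξ : Fin d → ℝ) (f : Ell d 1) :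
    fourierCLM ξ (heatOp d s t f) = Real.exp (-(t * symbol ξ ^ s)) • fourierCLM ξ f := by
  refine eigenfunctional_exp (F := (fourierCLM ξ).restrictScalars ℝ) (fun g => ?_) f
  rw [ContinuousLinearMap.coe_restrictScalars', smul_apply,
    ContinuousLinearMap.map_smul_of_tower, neg_apply, map_neg, fourierCLM_fracLap hs, neg_smul,
    mul_smul, smul_neg]

lemma isFracLaplacian_iff_eq (hs : s ∈ Set.Ioc 0 1) {f v : Ell d 1} :
    IsFracLaplacian s f v ↔ v = fracLap d s f := by
  have hconst : (((2 * Real.pi) ^ (-(d : ℝ) / 2) : ℝ) : ℂ) ≠ 0 :=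
    Complex.ofReal_ne_zero.mpr (Real.rpow_pos_of_pos (by positivity) _).ne'
  have hiff : IsFracLaplacian s f v ↔
      ∀ ξ ∈ torus d, fourierCLM ξ v = fourierCLM ξ (fracLap d s f) := by
    refine forall₂_congr fun ξ _ => ?_
    rw [fourierZ_eq, fourierZ_eq, fourierCLM_fracLap hs, mul_left_comm, mul_right_inj' hconst,
      Complex.real_smul]
  rw [hiff]
  exact ⟨eq_of_fourierCLM_eq, fun h ξ _ => by rw [h]⟩

lemma isSolution_heatOp (hs : s ∈ Set.Ioc 0 1) (u₀ : Ell d 1) :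
    IsSolution s u₀ fun t => heatOp d s t u₀ where
  continuousOn := fun t _ =>
    (hasDerivAt_exp_smul_apply (-fracLap d s) u₀ t).continuousAt.continuousWithinAt
  equation t _ := ⟨_, (isFracLaplacian_iff_eq hs).mpr rfl,
    hasDerivAt_exp_smul_apply (-fracLap d s) u₀ t⟩
  initial := by rw [heatOp_zero, one_apply_eq_self]

lemma IsSolution.eq_heatOp (hs : s ∈ Set.Ioc 0 1) {u₀ : Ell d 1} {u : ℝ → Ell d 1}
    (hu : IsSolution s u₀ u) {t : ℝ} (ht : 0 ≤ t) : u t = heatOp d s t u₀ := by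
  have hderiv (r : ℝ) (hr : 0 < r) : HasDerivAt u ((-fracLap d s) (u r)) r := by
    obtain ⟨v, hv, huv⟩ := hu.equation r hr
    rwa [(isFracLaplacian_iff_eq hs).mp hv] at huv
  rw [eq_exp_smul_apply_of_hasDerivAt hu.continuousOn hderiv ht, hu.initial, heatOp]

lemma heatOp_apply (hs : s ∈ Set.Ioc 0 1) {t : ℝ} (ht : 0 ≤ t) (f : Ell d 1) (x : Fin d → ℤ) :
    heatOp d s t f x = conv (heatKernel s t) f x := by
  have hbound (ξ : Fin d → ℝ) : ‖((Real.exp (-(t * symbol ξ ^ s)) : ℝ) : ℂ)‖ ≤ 1 := by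
    rw [Complex.norm_real, Real.norm_of_nonneg (Real.exp_nonneg _), Real.exp_le_one_iff,
      neg_nonpos]
    exact mul_nonneg ht (Real.rpow_nonneg (symbol_nonneg ξ) s)
  rw [← invFourier_fourierCLM (heatOp d s t f)]
  simp only [fourierCLM_heatOp hs, Complex.real_smul]
  exact invFourier_mul_fourierCLM (by unfold symbol; fun_prop) hbound f x

/-- The fundamental solution `e^{-t(-Δ)^s} δ₀`, as an element of `ℓ¹`. -/
def kernel (d : ℕ) (s t : ℝ) : Ell d 1 := heatOp d s t (lp.single 1 0 1)

lemma fourierCLM_kernel (hs : s ∈ Set.Ioc 0 1) (t : ℝ) (ξ : Fin d → ℝ) :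
    fourierCLM ξ (kernel d s t) = (Real.exp (-(t * symbol ξ ^ s)) : ℝ) := by
  rw [kernel, fourierCLM_heatOp hs, fourierCLM_single_zero, Complex.real_smul, mul_one]

lemma kernel_apply (hs : s ∈ Set.Ioc 0 1) (t : ℝ) (x : Fin d → ℤ) :
    kernel d s t x = heatKernel s t x := by
  rw [← invFourier_fourierCLM (kernel d s t)]
  simp only [fourierCLM_kernel hs]
  rfl

end Semigroup

section Unimodal

variable {d : ℕ} {j : Fin d}

/-- The closed cone of real sequences that, as functions of the coordinate `xⱼ` alone, are even and
nonincreasing in `|xⱼ|`. Evenness is the case `|xⱼ| = |yⱼ|` of the second condition. -/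
def unimodalCone (j : Fin d) : ProperCone ℝ (Ell d 1) where
  carrier := {f | (∀ x, (f x).im = 0) ∧
    ∀ x y : Fin d → ℤ, (∀ k ≠ j, x k = y k) → (x j).natAbs ≤ (y j).natAbs → (f y).re ≤ (f x).re}
  zero_mem' := by simp
  add_mem' hf hg :=
    ⟨fun x => by simp [hf.1 x, hg.1 x], fun x y h hxy => by
      simpa using add_le_add (hf.2 x y h hxy) (hg.2 x y h hxy)⟩
  smul_mem' c f hf := by
    have hre (x : Fin d → ℤ) : ((c • f) x).re = (c : ℝ) * (f x).re := Complex.smul_re (c : ℝ) (f x)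
    have him (x : Fin d → ℤ) : ((c • f) x).im = (c : ℝ) * (f x).im := Complex.smul_im (c : ℝ) (f x)
    refine ⟨fun x => by rw [him, hf.1 x, mul_zero], fun x y h hxy => ?_⟩
    rw [hre, hre]
    exact mul_le_mul_of_nonneg_left (hf.2 x y h hxy) c.2
  isClosed' := by
    have hev (x : Fin d → ℤ) : Continuous fun f : Ell d 1 => f x :=
      (lp.evalCLM ℂ (fun _ : Fin d → ℤ => ℂ) (p := 1) x).continuous
    have hre (x : Fin d → ℤ) := Complex.continuous_re.comp (hev x)
    have him (x : Fin d → ℤ) := Complex.continuous_im.comp (hev x)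
    simp only [Set.ofPred_and, Set.ofPred_forall]
    exact .inter (isClosed_iInter fun x => isClosed_eq (him x) continuous_const)
      (isClosed_iInter fun x => isClosed_iInter fun y => isClosed_iInter fun _ =>
        isClosed_iInter fun _ => isClosed_le (hre y) (hre x))

lemma mem_unimodalCone {f : Ell d 1} : f ∈ unimodalCone j ↔ (∀ x, (f x).im = 0) ∧
    ∀ x y : Fin d → ℤ, (∀ k ≠ j, x k = y k) → (x j).natAbs ≤ (y j).natAbs → (f y).re ≤ (f x).re :=
  Iff.rfl

lemma single_zero_mem_unimodalCone (j : Fin d) : lp.single 1 0 1 ∈ unimodalCone j := by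
  refine mem_unimodalCone.mpr ⟨fun x => ?_, fun x y h hxy => ?_⟩
  · rw [lp.single_apply, Pi.single_apply]
    split_ifs <;> simp
  rcases eq_or_ne y 0 with rfl | hy
  · have hx : x = 0 := by
      ext k
      rcases eq_or_ne k j with rfl | hk
      · simpa using hxy
      · exact h k hk
    rw [hx]
  · rw [lp.single_apply, lp.single_apply, Pi.single_apply, Pi.single_apply, if_neg hy]
    split_ifs <;> simp

lemma mapsTo_shift_unimodalCone {z : Fin d → ℤ} (hz : z j = 0) :
    Set.MapsTo (shift z) (unimodalCone j : Set (Ell d 1)) (unimodalCone j) :=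
  fun _ hf => ⟨fun _ => hf.1 _, fun x y h hxy => hf.2 _ _ (fun k hk => by simp [h k hk])
    (by simpa [hz] using hxy)⟩

lemma lazyStep_apply_apply (k : Fin d) (f : Ell d 1) (x : Fin d → ℤ) : lazyStep k f x
    = (4⁻¹ : ℝ) • ((2 : ℝ) • f x + f (x - Pi.single k 1) + f (x + Pi.single k 1)) := by
  rw [← sub_neg_eq_add x]
  rfl

lemma mapsTo_lazyStep_unimodalCone_of_ne {k : Fin d} (hk : k ≠ j) :
    Set.MapsTo (lazyStep k) (unimodalCone j : Set (Ell d 1)) (unimodalCone j) := by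
  intro f hf
  rw [lazyStep_apply]
  refine (unimodalCone j).smul_mem (add_mem (add_mem ((unimodalCone j).smul_mem hf zero_le_two)
    (mapsTo_shift_unimodalCone ?_ hf)) (mapsTo_shift_unimodalCone ?_ hf)) (by norm_num)
  all_goals simp [hk.symm]

/-- In the case `|xⱼ| < |yⱼ|` both neighbours of `x` dominate `y` and `x` dominates both neighbours
of `y`: comparing the neighbours with the site itself requires the walk to be lazy. -/
lemma mapsTo_lazyStep_self_unimodalCone (j : Fin d) :
    Set.MapsTo (lazyStep j) (unimodalCone j : Set (Ell d 1)) (unimodalCone j) := by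
  intro f hf
  refine mem_unimodalCone.mpr ⟨fun x => ?_, fun x y h hxy => ?_⟩
  · simp [lazyStep_apply_apply, hf.1]
  have hle {a b : ℤ} (hab : (x j + a).natAbs ≤ (y j + b).natAbs) :
      (f (y + Pi.single j b)).re ≤ (f (x + Pi.single j a)).re :=
    hf.2 _ _ (fun k hk => by simp [h k hk, hk]) (by simpa using hab)
  have hle₀ : (f y).re ≤ (f x).re := hf.2 x y h hxy
  simp only [lazyStep_apply_apply, sub_eq_add_neg, ← Pi.single_neg, Complex.smul_re,
    Complex.add_re, smul_eq_mul]
  rcases hxy.lt_or_eq with hlt | heq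
  · have hy (a : ℤ) (ha : (x j + a).natAbs ≤ (y j).natAbs) :
        (f y).re ≤ (f (x + Pi.single j a)).re := by
      simpa using hle (a := a) (b := 0) (by simpa using ha)
    have hx (b : ℤ) (hb : (x j).natAbs ≤ (y j + b).natAbs) :
        (f (y + Pi.single j b)).re ≤ (f x).re := by
      simpa using hle (a := 0) (b := b) (by simpa using hb)
    linarith [hy 1 (by lia), hy (-1) (by lia), hx 1 (by lia), hx (-1) (by lia)]
  · rcases Int.natAbs_eq_natAbs_iff.mp heq with heq | heq
    · linarith [hle (a := 1) (b := 1) (by rw [heq]), hle (a := -1) (b := -1) (by rw [heq])]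
    · linarith [hle (a := 1) (b := -1) (by lia), hle (a := -1) (b := 1) (by lia)]

lemma mapsTo_lazyWalk_unimodalCone (j : Fin d) :
    Set.MapsTo (lazyWalk d) (unimodalCone j : Set (Ell d 1)) (unimodalCone j) := by
  intro f hf
  rw [lazyWalk, smul_apply, sum_apply]
  refine (unimodalCone j).smul_mem (sum_mem fun k _ => ?_) (by positivity)
  rcases eq_or_ne k j with rfl | hk
  · exact mapsTo_lazyStep_self_unimodalCone k hf
  · exact mapsTo_lazyStep_unimodalCone_of_ne hk hf

lemma kernel_mem_unimodalCone {s t : ℝ} (hs : s ∈ Set.Ioc 0 1) (ht : 0 ≤ t) (j : Fin d) :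
    kernel d s t ∈ unimodalCone j := by
  rw [kernel, heatOp_eq_exp_smul_sub_one]
  exact mapsTo_cone_exp_smul_sub_one (by positivity) (mapsTo_cone_sibuyaSeries hs
    (norm_lazyWalk_le d) (mapsTo_lazyWalk_unimodalCone j)) (single_zero_mem_unimodalCone j)

lemma norm_sub_apply_of_mem_unimodalCone {f : Ell d 1} (hf : f ∈ unimodalCone j)
    (x : Fin d → ℤ) : ‖f x - f (x - Pi.single j 1)‖ =
      (if 1 ≤ x j then 1 else -1) * ((f (x - Pi.single j 1)).re - (f x).re) := by
  have hre : ‖f x - f (x - Pi.single j 1)‖ = |(f x).re - (f (x - Pi.single j 1)).re| := by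
    rw [← Complex.sub_re, Complex.abs_re_eq_norm.mpr (by simp [hf.1])]
  have hoff (k : Fin d) (hk : k ≠ j) : (x - Pi.single j 1 : Fin d → ℤ) k = x k := by simp [hk]
  have hself : (x - Pi.single j 1 : Fin d → ℤ) j = x j - 1 := by simp
  rw [hre]
  split_ifs with h
  · rw [one_mul, abs_sub_comm, abs_of_nonneg]
    exact sub_nonneg.mpr (hf.2 _ _ hoff (by lia))
  · rw [neg_one_mul, neg_sub, abs_of_nonneg]
    exact sub_nonneg.mpr (hf.2 _ _ (fun k hk => (hoff k hk).symm) (by lia))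

lemma norm_sub_shift_of_mem_unimodalCone {f : Ell d 1} (hf : f ∈ unimodalCone j) :
    ‖f - shift (Pi.single j 1) f‖ = 2 * ∑' x : Fin d → ℤ, if x j = 0 then (f x).re else 0 := by
  set e : Fin d → ℤ := Pi.single j 1
  set σ : (Fin d → ℤ) → ℝ := fun x => if 1 ≤ x j then 1 else -1
  have hσ_jump (x : Fin d → ℤ) : σ (x + e) - σ x = 2 * if x j = 0 then 1 else 0 := by
    simp only [σ, e, Pi.add_apply, Pi.single_eq_same]
    split_ifs <;> first | lia | norm_num
  have hsum (y : Fin d → ℤ) : Summable fun x => σ (x + y) * (f x).re := by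
    refine .of_norm_bounded (summable_norm f) fun x => ?_
    have hσ : ‖σ (x + y)‖ = 1 := by simp only [σ]; split_ifs <;> simp
    rw [norm_mul, hσ, one_mul]
    exact Complex.abs_re_le_norm _
  have hsum₀ : Summable fun x => σ x * (f x).re := by simpa only [add_zero] using hsum 0
  have hshift : HasSum (fun x => σ x * (f (x - e)).re) (∑' x, σ (x + e) * (f x).re) := by
    rw [← (Equiv.addRight e).hasSum_iff]
    simpa [Function.comp_def] using (hsum e).hasSum
  calc ‖f - shift e f‖
      = ∑' x, (σ x * (f (x - e)).re - σ x * (f x).re) := by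
        rw [norm_eq_tsum]
        exact tsum_congr fun x => (norm_sub_apply_of_mem_unimodalCone hf x).trans (mul_sub _ _ _)
    _ = ∑' x, (σ (x + e) * (f x).re - σ x * (f x).re) := by
        rw [hshift.summable.tsum_sub hsum₀, hshift.tsum_eq, (hsum e).tsum_sub hsum₀]
    _ = 2 * ∑' x : Fin d → ℤ, if x j = 0 then (f x).re else 0 := by
        rw [← tsum_mul_left]
        exact tsum_congr fun x => by rw [← sub_mul, hσ_jump]; split_ifs <;> ring

lemma integral_fourierCLM_single (j : Fin d) (f : Ell d 1) :
    ∫ η in Set.Icc (-Real.pi) Real.pi, fourierCLM (Pi.single j η) f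
      = 2 * Real.pi * ∑' x : Fin d → ℤ, if x j = 0 then f x else 0 := by
  have hchar (η : ℝ) (x : Fin d → ℤ) :
      latticeChar (Pi.single j η) x = Complex.exp (Complex.I * ((-x j : ℤ) * η)) := by
    rw [latticeChar, pairing, Finset.sum_eq_single j (fun k _ hk => by simp [hk]) (by simp),
      Pi.single_eq_same]
    push_cast
    ring_nf
  simp only [fourierCLM_apply, hchar]
  rw [integral_tsum_mul _ (fun x => by fun_prop) (C := 1) (fun x η => ?_), ← tsum_mul_left]
  · refine tsum_congr fun x => ?_
    rw [integral_exp_int]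
    split_ifs <;> simp_all [mul_comm]
  · rw [← hchar, norm_latticeChar]

lemma norm_sub_shift_le_integral_norm_fourierCLM {f : Ell d 1} (hf : f ∈ unimodalCone j) :
    ‖f - shift (Pi.single j 1) f‖
      ≤ Real.pi⁻¹ * ∫ η in Set.Icc (-Real.pi) Real.pi, ‖fourierCLM (Pi.single j η) f‖ := by
  have hreal : ∑' x : Fin d → ℤ, (if x j = 0 then f x else 0)
      = (∑' x : Fin d → ℤ, if x j = 0 then (f x).re else 0 : ℝ) := by
    rw [Complex.ofReal_tsum]
    refine tsum_congr fun x => ?_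
    split_ifs
    · exact Complex.ext rfl (hf.1 x)
    · simp
  set S := ∑' x : Fin d → ℤ, if x j = 0 then (f x).re else 0
  have hS : ‖f - shift (Pi.single j 1) f‖ = 2 * S := norm_sub_shift_of_mem_unimodalCone hf
  have hle : 2 * Real.pi * S ≤ ∫ η in Set.Icc (-Real.pi) Real.pi,
      ‖fourierCLM (Pi.single j η) f‖ := by
    refine (Complex.re_le_norm (2 * Real.pi * S : ℝ)).trans ?_
    push_cast
    rw [← hreal, ← integral_fourierCLM_single]
    exact norm_integral_le_integral_norm _
  rw [hS, inv_mul_eq_div, le_div_iff₀ Real.pi_pos]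
  linarith

end Unimodal

section KernelBounds

variable {d : ℕ}

/-- The stretched exponential `e^{-b|η|^p}`, which dominates the symbol of the semigroup in each
frequency variable. -/
def stretchedExp (p b η : ℝ) : ℝ := Real.exp (-(b * |η| ^ p))

lemma continuous_stretchedExp {p : ℝ} (hp : 0 ≤ p) (b : ℝ) : Continuous (stretchedExp p b) :=
  Real.continuous_exp.comp
    (continuous_const.mul (continuous_abs.rpow_const fun _ => .inr hp)).neg

lemma integral_stretchedExp {p b : ℝ} (hp : 0 < p) (hb : 0 < b) :
    ∫ η, stretchedExp p b η = 2 * Real.Gamma (1 / p + 1) * b ^ (-(1 / p)) := by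
  have h := integral_exp_neg_mul_rpow hp hb
  simp only [neg_mul] at h
  simp only [stretchedExp]
  rw [integral_comp_abs (f := fun η => Real.exp (-(b * η ^ p))), h, neg_div]
  ring

lemma setIntegral_stretchedExp_le {p b : ℝ} (hp : 0 < p) (hb : 0 < b) (S : Set ℝ) :
    ∫ η in S, stretchedExp p b η ≤ 2 * Real.Gamma (1 / p + 1) * b ^ (-(1 / p)) := by
  have : 0 < Real.Gamma (1 / p + 1) := Real.Gamma_pos_of_pos (by positivity)
  have hne : ∫ η, stretchedExp p b η ≠ 0 := by
    rw [integral_stretchedExp hp hb]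
    positivity
  rw [← integral_stretchedExp hp hb]
  exact setIntegral_le_integral (not_imp_comm.mp integral_undef hne)
    (.of_forall fun η => Real.exp_nonneg _)

lemma exists_setIntegral_stretchedExp_le {p b : ℝ} (hp : 0 < p) (hb : 0 < b) :
    ∃ C > 0, ∀ t > 0, ∀ S : Set ℝ,
      ∫ η in S, stretchedExp p (t * b) η ≤ C * t ^ (-(1 / p)) := by
  have : 0 < Real.Gamma (1 / p + 1) := Real.Gamma_pos_of_pos (by positivity)
  refine ⟨2 * Real.Gamma (1 / p + 1) * b ^ (-(1 / p)), by positivity, fun t ht S => ?_⟩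
  refine (setIntegral_stretchedExp_le hp (mul_pos ht hb) S).trans_eq ?_
  rw [Real.mul_rpow ht.le hb.le]
  ring

lemma mul_abs_le_two_mul_abs_sin_half {x : ℝ} (hx : |x| ≤ Real.pi) :
    2 / Real.pi * |x| ≤ 2 * |Real.sin (x / 2)| := by
  have h := Real.mul_abs_le_abs_sin (x := x / 2) (by rw [abs_div, abs_two]; linarith)
  rw [abs_div, abs_two] at h
  linarith

lemma mul_abs_rpow_le_symbol_rpow {s : ℝ} (hs : 0 ≤ s) {ξ : Fin d → ℝ} {j : Fin d}
    (hξ : |ξ j| ≤ Real.pi) : (2 / Real.pi) ^ (2 * s) * |ξ j| ^ (2 * s) ≤ symbol ξ ^ s := by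
  have hsq : (2 / Real.pi * |ξ j|) ^ 2 ≤ symbol ξ := by
    calc (2 / Real.pi * |ξ j|) ^ 2 ≤ (2 * |Real.sin (ξ j / 2)|) ^ 2 :=
          pow_le_pow_left₀ (by positivity) (mul_abs_le_two_mul_abs_sin_half hξ) 2
      _ = 4 * Real.sin (ξ j / 2) ^ 2 := by rw [mul_pow, sq_abs]; norm_num
      _ ≤ symbol ξ := mul_le_mul_of_nonneg_left (Finset.single_le_sum
          (f := fun k => Real.sin (ξ k / 2) ^ 2) (fun _ _ => sq_nonneg _) (Finset.mem_univ j))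
          zero_le_four
  rw [← Real.mul_rpow (by positivity) (abs_nonneg _), Real.rpow_mul (by positivity)]
  exact Real.rpow_le_rpow (by positivity) (by exact_mod_cast hsq) hs

lemma exp_neg_symbol_le_stretchedExp {s t : ℝ} (hs : 0 ≤ s) (ht : 0 ≤ t) {ξ : Fin d → ℝ}
    {j : Fin d} (hξ : |ξ j| ≤ Real.pi) :
    Real.exp (-(t * symbol ξ ^ s))
      ≤ stretchedExp (2 * s) (t * (2 / Real.pi) ^ (2 * s)) (ξ j) := by
  rw [stretchedExp, Real.exp_le_exp, neg_le_neg_iff, mul_assoc]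
  exact mul_le_mul_of_nonneg_left (mul_abs_rpow_le_symbol_rpow hs hξ) ht

variable [NeZero d] {s : ℝ}

lemma exp_neg_symbol_le_prod_stretchedExp {t : ℝ} (hs : 0 ≤ s) (ht : 0 ≤ t) {ξ : Fin d → ℝ}
    (hξ : ξ ∈ torus d) : Real.exp (-(t * symbol ξ ^ s)) ≤
      ∏ j, stretchedExp (2 * s) (t * ((2 / Real.pi) ^ (2 * s) / d)) (ξ j) := by
  have hd : (d : ℝ) ≠ 0 := NeZero.ne _
  calc Real.exp (-(t * symbol ξ ^ s)) = ∏ _ : Fin d, Real.exp (-(t / d * symbol ξ ^ s)) := by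
        rw [Finset.prod_const, Finset.card_univ, Fintype.card_fin, ← Real.exp_nat_mul]
        congr 1
        field_simp
    _ ≤ ∏ j, stretchedExp (2 * s) (t / d * (2 / Real.pi) ^ (2 * s)) (ξ j) :=
        Finset.prod_le_prod (fun _ _ => Real.exp_nonneg _) fun j _ =>
          exp_neg_symbol_le_stretchedExp hs (by positivity) (abs_le.mpr (hξ j (Set.mem_univ j)))
    _ = _ := by rw [div_mul_comm, mul_comm _ t]

lemma exists_norm_kernel_sub_shift_le (hs : s ∈ Set.Ioc 0 1) :
    ∃ C > 0, ∀ t > 0, ∀ j : Fin d,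
      ‖kernel d s t - shift (Pi.single j 1) (kernel d s t)‖ ≤ C * t ^ (-(1 / (2 * s))) := by
  have hs₀ := hs.1
  obtain ⟨C, hC, hint⟩ := exists_setIntegral_stretchedExp_le (p := 2 * s)
    (b := (2 / Real.pi) ^ (2 * s)) (by positivity) (by positivity)
  refine ⟨Real.pi⁻¹ * C, by positivity, fun t ht j => ?_⟩
  have hle (η : ℝ) (hη : η ∈ Set.Icc (-Real.pi) Real.pi) :
      ‖fourierCLM (Pi.single j η) (kernel d s t)‖
        ≤ stretchedExp (2 * s) (t * (2 / Real.pi) ^ (2 * s)) η := by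
    rw [fourierCLM_kernel hs, Complex.norm_real, Real.norm_of_nonneg (Real.exp_nonneg _)]
    simpa using exp_neg_symbol_le_stretchedExp (ξ := Pi.single j η) (j := j) hs₀.le ht.le
      (by simpa using abs_le.mpr hη)
  rw [mul_assoc]
  refine (norm_sub_shift_le_integral_norm_fourierCLM (kernel_mem_unimodalCone hs ht.le j)).trans
    (mul_le_mul_of_nonneg_left (le_trans ?_ (hint t ht (Set.Icc (-Real.pi) Real.pi)))
      (by positivity))
  exact integral_mono_of_nonneg (.of_forall fun η => norm_nonneg _)
    (continuous_stretchedExp (by positivity) _).integrableOn_Icc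
    ((ae_restrict_mem measurableSet_Icc).mono hle)

lemma norm_kernel_apply_le {t : ℝ} (hs : s ∈ Set.Ioc 0 1) (ht : 0 ≤ t) (x : Fin d → ℤ) :
    ‖kernel d s t x‖ ≤ 1 / (2 * Real.pi) ^ d * (∫ η in Set.Icc (-Real.pi) Real.pi,
      stretchedExp (2 * s) (t * ((2 / Real.pi) ^ (2 * s) / d)) η) ^ d := by
  have hs₀ := hs.1
  have hprefactor : ‖1 / (2 * (Real.pi : ℂ)) ^ d‖ = 1 / (2 * Real.pi) ^ d := by
    simp [abs_of_pos Real.pi_pos]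
  rw [kernel_apply hs, heatKernel, norm_mul, hprefactor]
  refine mul_le_mul_of_nonneg_left ?_ (by positivity)
  set g := stretchedExp (2 * s) (t * ((2 / Real.pi) ^ (2 * s) / d))
  have hg : IntegrableOn g (Set.Icc (-Real.pi) Real.pi) :=
    (continuous_stretchedExp (by positivity) _).integrableOn_Icc
  calc _ ≤ ∫ ξ in torus d, ∏ j, g (ξ j) := by
        refine norm_integral_le_of_norm_le ?_ ?_
        · rw [volume_restrict_torus]
          exact .fintype_prod fun _ => hg
        · filter_upwards [ae_restrict_mem (MeasurableSet.univ_pi fun _ => measurableSet_Icc)]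
            with ξ hξ
          rw [norm_mul, Complex.norm_exp_I_mul_ofReal, mul_one, Complex.norm_real,
            Real.norm_of_nonneg (Real.exp_nonneg _)]
          exact exp_neg_symbol_le_prod_stretchedExp hs₀.le ht hξ
    _ = (∫ η in Set.Icc (-Real.pi) Real.pi, g η) ^ d := by
        rw [volume_restrict_torus, integral_fintype_prod_eq_pow, Fintype.card_fin]

lemma exists_norm_kernel_apply_le (hs : s ∈ Set.Ioc 0 1) :
    ∃ C > 0, ∀ t > 0, ∀ x, ‖kernel d s t x‖ ≤ C * t ^ (-((d : ℝ) / (2 * s))) := by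
  have hs₀ := hs.1
  have hd : (0 : ℝ) < d := Nat.cast_pos.mpr (Nat.pos_of_neZero d)
  obtain ⟨C, hC, hint⟩ := exists_setIntegral_stretchedExp_le (p := 2 * s)
    (b := (2 / Real.pi) ^ (2 * s) / d) (by positivity) (by positivity)
  refine ⟨1 / (2 * Real.pi) ^ d * C ^ d, by positivity, fun t ht x => ?_⟩
  refine (norm_kernel_apply_le hs ht.le x).trans ?_
  rw [mul_assoc]
  refine mul_le_mul_of_nonneg_left ?_ (by positivity)
  calc _ ≤ (C * t ^ (-(1 / (2 * s)))) ^ d :=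
        pow_le_pow_left₀ (integral_nonneg fun η => Real.exp_nonneg _) (hint t ht _) d
    _ = C ^ d * t ^ (-((d : ℝ) / (2 * s))) := by
        rw [mul_pow, ← Real.rpow_mul_natCast ht.le]
        ring_nf

end KernelBounds

section Asymptotics

variable {d : ℕ}

lemma abs_apply_le_euclid (y : Fin d → ℤ) (j : Fin d) : |(y j : ℝ)| ≤ euclid y :=
  Real.abs_le_sqrt (Finset.single_le_sum (f := fun k => (y k : ℝ) ^ 2)
    (fun _ _ => sq_nonneg _) (Finset.mem_univ j))

lemma norm_sub_shift_le_mul_euclid {f : Ell d 1} {B : ℝ}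
    (hB : ∀ j, ‖f - shift (Pi.single j 1) f‖ ≤ B) (y : Fin d → ℤ) :
    ‖f - shift y f‖ ≤ d * (euclid y * B) := by
  calc ‖f - shift y f‖ ≤ ∑ j, |(y j : ℝ)| * ‖f - shift (Pi.single j 1) f‖ :=
        addGroupSeminorm_le_sum (translationModulus f) y
    _ ≤ ∑ _ : Fin d, euclid y * B := Finset.sum_le_sum fun j _ =>
        mul_le_mul (abs_apply_le_euclid y j) (hB j) (norm_nonneg _) (Real.sqrt_nonneg _)
    _ = d * (euclid y * B) := by simp

lemma norm_conv_apply_le {k : (Fin d → ℤ) → ℂ} {B : ℝ} (hB : ∀ x, ‖k x‖ ≤ B) (f : Ell d 1)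
    (x : Fin d → ℤ) : ‖conv k f x‖ ≤ B * ‖f‖ := by
  rw [norm_eq_tsum, ← tsum_mul_left]
  refine tsum_of_norm_bounded ((summable_norm f).mul_left B).hasSum fun y => ?_
  rw [norm_mul]
  exact mul_le_mul_of_nonneg_right (hB _) (norm_nonneg _)

lemma hasSum_smul_shift {f k g : Ell d 1} (hg : ⇑g = conv k f) :
    HasSum (fun y => f y • shift y k) g := by
  have hsum : Summable fun y => f y • shift y k :=
    .of_norm (by simpa [norm_smul] using (summable_norm f).mul_right ‖k‖)
  convert hsum.hasSum
  ext x
  rw [hg]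
  exact ((hsum.hasSum.mapL (lp.evalCLM ℂ (fun _ : Fin d → ℤ => ℂ) (p := 1) x)).tsum_eq.symm.trans
    (tsum_congr fun y => mul_comm _ _)).symm

lemma norm_sub_mass_smul_le {f k g : Ell d 1} (hg : ⇑g = conv k f) {B : ℝ}
    (hf : HasFiniteFirstMoment f) (hB : ∀ j, ‖k - shift (Pi.single j 1) k‖ ≤ B) :
    ‖g - mass f • k‖ ≤ d * B * firstMoment f := by
  have hsum : HasSum (fun y => f y • (shift y k - k)) (g - mass f • k) := by
    simp only [smul_sub]
    exact (hasSum_smul_shift hg).sub ((summable_norm f).of_norm.hasSum.smul_const k)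
  rw [← hsum.tsum_eq, firstMoment, ← tsum_mul_left]
  refine tsum_of_norm_bounded (hf.mul_left (d * B)).hasSum fun y => ?_
  calc ‖f y • (shift y k - k)‖ = ‖f y‖ * ‖k - shift y k‖ := by rw [norm_smul, norm_sub_rev]
    _ ≤ ‖f y‖ * (d * (euclid y * B)) :=
        mul_le_mul_of_nonneg_left (norm_sub_shift_le_mul_euclid hB y) (norm_nonneg _)
    _ = d * B * (euclid y * ‖f y‖) := by ring

/-- The remainder `G_t * f - M G_t` of the first-order asymptotics of the solution with initial
value `f`, where `M` is the mass of `f`. -/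
def heatRemainder (d : ℕ) (s t : ℝ) (f : Ell d 1) : Ell d 1 :=
  heatOp d s t f - mass f • kernel d s t

lemma firstMoment_nonneg (f : (Fin d → ℤ) → ℂ) : 0 ≤ firstMoment f :=
  tsum_nonneg fun _ => mul_nonneg (Real.sqrt_nonneg _) (norm_nonneg _)

variable [NeZero d] {s : ℝ}

lemma fourierCLM_heatRemainder (hs : s ∈ Set.Ioc 0 1) (t : ℝ) (ξ : Fin d → ℝ) (f : Ell d 1) :
    fourierCLM ξ (heatRemainder d s t f)
      = (Real.exp (-(t * symbol ξ ^ s)) : ℝ) * (fourierCLM ξ f - mass f) := by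
  rw [heatRemainder, map_sub, map_smul, fourierCLM_heatOp hs, fourierCLM_kernel hs,
    Complex.real_smul, smul_eq_mul]
  ring

lemma heatRemainder_add (hs : s ∈ Set.Ioc 0 1) (t r : ℝ) (f : Ell d 1) :
    heatRemainder d s (t + r) f = heatOp d s t (heatRemainder d s r f) := by
  refine eq_of_fourierCLM_eq fun ξ _ => ?_
  rw [fourierCLM_heatOp hs, fourierCLM_heatRemainder hs, fourierCLM_heatRemainder hs,
    Complex.real_smul, ← mul_assoc, ← Complex.ofReal_mul, ← Real.exp_add, ← neg_add, ← add_mul]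

lemma exists_norm_heatRemainder_le (hs : s ∈ Set.Ioc 0 1) :
    ∃ C > 0, ∀ f : Ell d 1, HasFiniteFirstMoment f → ∀ t > 0,
      ‖heatRemainder d s t f‖ ≤ C * firstMoment f * t ^ (-(1 / (2 * s))) := by
  obtain ⟨C, hC, hkernel⟩ := exists_norm_kernel_sub_shift_le (d := d) hs
  refine ⟨d * C, by have := Nat.pos_of_neZero d; positivity, fun f hf t ht => ?_⟩
  have hconv : ⇑(heatOp d s t f) = conv (kernel d s t) f := by
    ext x
    simp only [heatOp_apply hs ht.le, conv, kernel_apply hs]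
  refine (norm_sub_mass_smul_le hconv hf (hkernel t ht)).trans_eq ?_
  ring

lemma exists_norm_heatOp_apply_le (hs : s ∈ Set.Ioc 0 1) :
    ∃ C > 0, ∀ (f : Ell d 1), ∀ t > 0, ∀ x,
      ‖heatOp d s t f x‖ ≤ C * t ^ (-((d : ℝ) / (2 * s))) * ‖f‖ := by
  obtain ⟨C, hC, hkernel⟩ := exists_norm_kernel_apply_le (d := d) hs
  refine ⟨C, hC, fun f t ht x => ?_⟩
  rw [heatOp_apply hs ht.le]
  exact norm_conv_apply_le (fun z => by simpa only [kernel_apply hs] using hkernel t ht z) f x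

lemma exists_norm_heatRemainder_apply_le (hs : s ∈ Set.Ioc 0 1) :
    ∃ C > 0, ∀ f : Ell d 1, HasFiniteFirstMoment f → ∀ t > 0, ∀ x,
      t ^ ((d : ℝ) / (2 * s)) * ‖heatRemainder d s t f x‖
        ≤ C * firstMoment f * t ^ (-(1 / (2 * s))) := by
  obtain ⟨C₁, hC₁, hremainder⟩ := exists_norm_heatRemainder_le (d := d) hs
  obtain ⟨C, hC, hsmoothing⟩ := exists_norm_heatOp_apply_le (d := d) hs
  set α : ℝ := (d : ℝ) / (2 * s)
  set β : ℝ := 1 / (2 * s)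
  refine ⟨C * 2 ^ α * (C₁ * 2 ^ β), by positivity, fun f hf t ht x => ?_⟩
  have hhalf (r : ℝ) : (t / 2) ^ (-r) = 2 ^ r * t ^ (-r) := by
    rw [Real.div_rpow ht.le zero_le_two, Real.rpow_neg zero_le_two, div_inv_eq_mul, mul_comm]
  have hcancel : t ^ α * t ^ (-α) = 1 := by rw [← Real.rpow_add ht, add_neg_cancel, Real.rpow_zero]
  calc t ^ α * ‖heatRemainder d s t f x‖
      = t ^ α * ‖heatOp d s (t / 2) (heatRemainder d s (t / 2) f) x‖ := by
        rw [← heatRemainder_add hs, add_halves]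
    _ ≤ t ^ α * (C * (t / 2) ^ (-α) * (C₁ * firstMoment f * (t / 2) ^ (-β))) := by
        refine mul_le_mul_of_nonneg_left ((hsmoothing _ _ (half_pos ht) x).trans ?_) (by positivity)
        exact mul_le_mul_of_nonneg_left (hremainder f hf _ (half_pos ht)) (by positivity)
    _ = t ^ α * t ^ (-α) * (C * 2 ^ α * (C₁ * 2 ^ β) * firstMoment f * t ^ (-β)) := by
        rw [hhalf, hhalf]
        ring
    _ = C * 2 ^ α * (C₁ * 2 ^ β) * firstMoment f * t ^ (-β) := by rw [hcancel, one_mul]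

lemma exists_weighted_norm_heatRemainder_le (hs : s ∈ Set.Ioc 0 1) :
    ∃ C > 0, ∀ f : Ell d 1, HasFiniteFirstMoment f → ∀ t > 0, ∀ (p : ℝ≥0∞), 1 ≤ p →
      ∃ h : Memℓp (⇑(heatRemainder d s t f)) p,
      t ^ ((d : ℝ) / (2 * s) * (1 - (p⁻¹).toReal)) * ‖(⟨_, h⟩ : Ell d p)‖
        ≤ C * firstMoment f * t ^ (-(1 / (2 * s))) := by
  obtain ⟨C₁, hC₁, h₁⟩ := exists_norm_heatRemainder_le (d := d) hs
  obtain ⟨C₂, _, h_top⟩ := exists_norm_heatRemainder_apply_le (d := d) hs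
  refine ⟨max C₁ C₂, lt_max_of_lt_left hC₁, fun f hf t ht p hp => ⟨memℓp_of_one_le hp _, ?_⟩⟩
  have hN := firstMoment_nonneg f
  refine weighted_norm_lp_le hp _ ht ((h₁ f hf t ht).trans ?_)
    (fun x => (h_top f hf t ht x).trans ?_) _
  · gcongr
    exact le_max_left _ _
  · gcongr
    exact le_max_right _ _

end Asymptotics

end LatticeDiffusion

end

theorem theorem1p3 (d : ℕ) (hd : 1 ≤ d) (s : ℝ) (hs : s ∈ Set.Ioc (0 : ℝ) 1) :
    -- the Cauchy problem is well posed in `ℓ¹`, and its solution is `G_t * u₀`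
    (∀ u₀ : LatticeDiffusion.Ell d 1,
      (∃ u : ℝ → LatticeDiffusion.Ell d 1, LatticeDiffusion.IsSolution s u₀ u) ∧
      ∀ u : ℝ → LatticeDiffusion.Ell d 1, LatticeDiffusion.IsSolution s u₀ u →
        ∀ t : ℝ, 0 ≤ t → ∀ x : Fin d → ℤ,
          u t x = LatticeDiffusion.conv (LatticeDiffusion.heatKernel s t) u₀ x) ∧
    -- the first-order asymptotics, with a constant that depends on `d` and `s` only
    ∃ C : ℝ, 0 < C ∧
      ∀ (u₀ : LatticeDiffusion.Ell d 1), LatticeDiffusion.HasFiniteFirstMoment u₀ →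
      ∀ (u : ℝ → LatticeDiffusion.Ell d 1), LatticeDiffusion.IsSolution s u₀ u →
      ∀ t : ℝ, 0 < t →
        (∃ h : Memℓp (fun x : Fin d → ℤ =>
            u t x - LatticeDiffusion.mass u₀ * LatticeDiffusion.heatKernel s t x) ⊤,
          t ^ ((d : ℝ) / (2 * s)) * ‖(⟨_, h⟩ : LatticeDiffusion.Ell d ⊤)‖
            ≤ C * LatticeDiffusion.firstMoment u₀ * t ^ (-(1 / (2 * s)))) ∧
        (∃ h : Memℓp (fun x : Fin d → ℤ =>
            u t x - LatticeDiffusion.mass u₀ * LatticeDiffusion.heatKernel s t x) 1,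
          ‖(⟨_, h⟩ : LatticeDiffusion.Ell d 1)‖
            ≤ C * LatticeDiffusion.firstMoment u₀ * t ^ (-(1 / (2 * s)))) ∧
        (∀ p : ENNReal, 1 ≤ p →
          ∃ h : Memℓp (fun x : Fin d → ℤ =>
            u t x - LatticeDiffusion.mass u₀ * LatticeDiffusion.heatKernel s t x) p,
          t ^ ((d : ℝ) / (2 * s) * (1 - (p⁻¹).toReal)) * ‖(⟨_, h⟩ : LatticeDiffusion.Ell d p)‖
            ≤ C * LatticeDiffusion.firstMoment u₀ * t ^ (-(1 / (2 * s)))) := by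
  have : NeZero d := ⟨by lia⟩
  refine ⟨fun u₀ => ⟨⟨_, LatticeDiffusion.isSolution_heatOp hs u₀⟩, fun u hu t ht x => ?_⟩, ?_⟩
  · rw [hu.eq_heatOp hs ht, LatticeDiffusion.heatOp_apply hs ht]
  obtain ⟨C, hC, hbound⟩ := LatticeDiffusion.exists_weighted_norm_heatRemainder_le (d := d) hs
  refine ⟨C, hC, fun u₀ hu₀ u hu t ht => ?_⟩
  have hremainder : (fun x : Fin d → ℤ =>
      u t x - LatticeDiffusion.mass u₀ * LatticeDiffusion.heatKernel s t x) =
      LatticeDiffusion.heatRemainder d s t u₀ := by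
    ext x
    rw [hu.eq_heatOp hs ht.le, ← LatticeDiffusion.kernel_apply hs]
    rfl
  have hweighted := hbound u₀ hu₀ t ht
  rw [hremainder]
  exact ⟨by simpa using hweighted ⊤ le_top, by simpa using hweighted 1 le_rfl, hweighted⟩
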